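/- Let $X$ be a complete CAT(0) space, i.e. a complete metric space $(X,d)$ with a convexity mapping $W:X\times X\times[0,1]\to X$, written $(1-\lambda)x+\lambda y:=W(x,y,\lambda)$, such that for all $x,y,z,w\in X$ and $\lambda,\tilde\lambda\in[0,1]$: $d(z,W(x,y,\lambda))\le(1-\lambda)d(z,x)+\lambda d(z,y)$; $d(W(x,y,\lambda),W(x,y,\tilde\lambda))=|\lambda-\tilde\lambda|d(x,y)$; $W(x,y,\lambda)=W(y,x,1-\lambda)$; $d(W(x,z,\lambda),W(y,w,\lambda))\le(1-\lambda)d(x,y)+\lambda d(z,w)$; and $d^2(z,W(x,y,\tfrac12))\le\tfrac12d^2(z,x)+\tfrac12d^2(z,y)-\tfrac14d^2(x,y)$. Let $\emptyset\ne C\subseteq X$ be closed and convex, let $T_n:C\to C$ ($n\in\mathbb N$) be nonexpansive with a common fixed point $z\in C$, and let $(\lambda_n)\subseteq(0,\infty)$ be such that $$d(T_ny,T_my)\le\left|1-\frac{\lambda_m}{\lambda_n}\right|d(y,T_ny)\qquad\text{for all }y\in C,\ m,n\in\mathbb N .$$ A sequence $(a_n)$ converges to $a$ with rate $\varphi:\mathbb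 N\to\mathbb N$ if $d(a_n,a)\le\frac1{k+1}$ whenever $n\ge\varphi(k)$. Assume that $\lambda_n\to\lambda>0$ with rate $\theta_4$. Let $(\alpha_n)\subseteq(0,1]$ satisfy (H1$\alpha_n$) $\sum_{i=0}^{\sigma_1(n)}\alpha_i\ge n$ for all $n\in\mathbb N$; (H4$\alpha_n$) $\frac{|\alpha_{n+1}-\alpha_n|}{\alpha_n^2}\to0$ with rate $\sigma_4$, where $\sigma_1,\sigma_4:\mathbb N\to\mathbb N$. Let $u,x_0^*\in C$ and let $x^*_{n+1}=\alpha_nu+(1-\alpha_n)T_nx^*_n$ be the abstract HPPA. Let $K\in\mathbb N$, $K\ge1$, with $K\ge\max\{d(x_0^*,z),d(u,z)\}$. Then for every $x\in C$ the limit $\tilde Tx=\lim_nT_nx$ exists and lies in $C$, and for every $n$ there is a unique $y_n^*\in C$ with $y^*_n=\alpha_nu+(1-\alpha_n)\tilde Ty^*_n$. Define $$\psi^*(k)=\max\left\{\theta_4\left(\left\lceil\frac{4K(k+1)}{\lambda}\right\rceil-1\right),\sigma_4(4K(k+1)-1)\right\},$$ $$\Sigma^*(k)=\sigma_1\big(\psi^*(2k+1)+\lceil\ln(4K(k+1))\rceil\big)+1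 .$$ Then $d(x^*_n,y^*_n)\to0$ with rate of convergence $\Sigma^*$, and $d(y^*_n,u)\le3K$ for all $n$. Let $M\in\mathbb N$, $M\ge1$, be such that $d(y_n^*,u)\le M$ for all $n$ (e.g. $M=3K$). For $g:\mathbb N\to\mathbb N$ put $\tilde g(n)=n+g(n)$ and $g^+(n)=\max_{i\le n}g(i)$, and let $g^{(n)}$ be the $n$-th iterate of $g$. Assume one of the following. (a) $(\alpha_n)$ is nonincreasing; in this case let $\Omega^*(k,g)=\tilde g^{(M^2(k+1)^2)}(0)$. (b) $\alpha_n\to0$ with rate $\sigma_3$, and $h:\mathbb N\to\mathbb N$ satisfies $\alpha_n\ge\frac1{h(n)+1}$ for all $n$; in this case let $\Omega^*(k,g)=\sigma_3^+\big(g_h^{(4M^2(k+1)^2)}(0)\big)$, where $g_h(n)=\max\{h(i)\mid 0\le i\le\tilde g(\sigma_3(n))\}$. In each case $(y^*_n)$ is Cauchy with rate of metastability $\Omega^*$, and $(x^*_n)$ is Cauchy with rate of metastability $$\Phi^*(k,g)=\max\{\Sigma^*(3k+2),\Omega^*(3k+2,h_{k,g})\},$$ where $$h_{k,g}(m)=\max\{\Sigma^*(3k+2),m\}-m+g(\max\{\Sigma^*(3k+2),m\}).$$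 Here $\Omega:\mathbb N\times\mathbb N^{\mathbb N}\to\mathbb N$ is a rate of metastability of $(a_n)$ if for all $k\in\mathbb N$ and $g:\mathbb N\to\mathbb N$ there is $N\le\Omega(k,g)$ such that $d(a_i,a_j)\le\frac1{k+1}$ for all $i,j\in[N,N+g(N)]$. -/

import Mathlib

open Filter Topology

namespace HPPA

/-- `W`-hyperbolic spaces. `W x y t` stands for the convex combination `(1 - t) x + t y`;
only the values for `t ∈ [0, 1]` are relevant. -/
structure IsWHyperbolic {X : Type*} [MetricSpace X] (W : X → X → ℝ → X) : Prop where
  w1 : ∀ x y z : X, ∀ t ∈ Set.Icc (0 : ℝ) 1,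
    dist z (W x y t) ≤ (1 - t) * dist z x + t * dist z y
  w2 : ∀ x y : X, ∀ t ∈ Set.Icc (0 : ℝ) 1, ∀ s ∈ Set.Icc (0 : ℝ) 1,
    dist (W x y t) (W x y s) = |t - s| * dist x y
  w3 : ∀ x y : X, ∀ t ∈ Set.Icc (0 : ℝ) 1, W x y t = W y x (1 - t)
  w4 : ∀ x y z w : X, ∀ t ∈ Set.Icc (0 : ℝ) 1,
    dist (W x z t) (W y w t) ≤ (1 - t) * dist x y + t * dist z w

/-- CAT(0) spaces, as `W`-hyperbolic spaces satisfying the Bruhat–Tits inequality. -/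
structure IsCAT0 {X : Type*} [MetricSpace X] (W : X → X → ℝ → X) : Prop
    extends IsWHyperbolic W where
  cn : ∀ x y z : X, dist z (W x y (1 / 2)) ^ 2 ≤
    1 / 2 * dist z x ^ 2 + 1 / 2 * dist z y ^ 2 - 1 / 4 * dist x y ^ 2

/-- Convex subsets of a `W`-space (nonemptiness is stated separately). -/
def IsWConvex {X : Type*} (W : X → X → ℝ → X) (C : Set X) : Prop :=
  ∀ x ∈ C, ∀ y ∈ C, ∀ t ∈ Set.Icc (0 : ℝ) 1, W x y t ∈ C

/-- `φ` is a rate of convergence of `x` to `l`. -/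
def IsRateOfConvergence {X : Type*} [MetricSpace X] (x : ℕ → X) (l : X) (φ : ℕ → ℕ) : Prop :=
  ∀ k n : ℕ, φ k ≤ n → dist (x n) l ≤ 1 / ((k : ℝ) + 1)

/-- `θ` is a rate of divergence of the series `∑ a i` (of nonnegative reals). -/
def IsRateOfDivergence (a : ℕ → ℝ) (θ : ℕ → ℕ) : Prop :=
  ∀ n : ℕ, (n : ℝ) ≤ ∑ i ∈ Finset.range (θ n + 1), a i

/-- `Ω` is a rate of metastability of `x`. -/
def IsRateOfMetastability {X : Type*} [MetricSpace X] (x : ℕ → X)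
    (Ω : ℕ → (ℕ → ℕ) → ℕ) : Prop :=
  ∀ (k : ℕ) (g : ℕ → ℕ), ∃ N ≤ Ω k g, ∀ i ∈ Set.Icc N (N + g N), ∀ j ∈ Set.Icc N (N + g N),
    dist (x i) (x j) ≤ 1 / ((k : ℝ) + 1)

/-- The sequence `x` is Cauchy with rate of metastability `Ω`. -/
def IsCauchyWithMetastabilityRate {X : Type*} [MetricSpace X] (x : ℕ → X)
    (Ω : ℕ → (ℕ → ℕ) → ℕ) : Prop :=
  CauchySeq x ∧ IsRateOfMetastability x Ω

/-- The family `(T n)` satisfies `Res((lam n), n, m)` on `C` for all `m, n`. -/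
def IsResolventLike {X : Type*} [MetricSpace X] (C : Set X) (T : ℕ → X → X)
    (lam : ℕ → ℝ) : Prop :=
  ∀ n m : ℕ, ∀ y ∈ C, dist (T n y) (T m y) ≤ |1 - lam m / lam n| * dist y (T n y)

/-- The abstract HPPA: `x 0 = x₀` and `x (n+1) = α n • u + (1 - α n) • T n (x n)`. -/
def hppa {X : Type*} (W : X → X → ℝ → X) (α : ℕ → ℝ) (T : ℕ → X → X) (u x₀ : X) : ℕ → X
  | 0 => x₀
  | n + 1 => W u (T n (hppa W α T u x₀ n)) (1 - α n)

/-- The pointwise limit of the maps `T n`. -/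
noncomputable def limitMap {X : Type*} [MetricSpace X] (T : ℕ → X → X) (x : X) : X :=
  haveI : Nonempty X := ⟨x⟩
  limUnder atTop (fun n => T n x)

/-- The point `y ∈ C` satisfies `y = α n • u + (1 - α n) • T' y`, where `T'` is the pointwise
limit of the maps `T n`. -/
def IsBrowderPoint {X : Type*} [MetricSpace X] (W : X → X → ℝ → X) (C : Set X) (α : ℕ → ℝ)
    (T : ℕ → X → X) (u : X) (n : ℕ) (y : X) : Prop :=
  y ∈ C ∧ y = W u (limitMap T y) (1 - α n)

/-- The Browder-type sequence: its `n`-th term is the (unique) point of `C` given by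
`IsBrowderPoint`. -/
noncomputable def browderSeq {X : Type*} [MetricSpace X] (W : X → X → ℝ → X) (C : Set X)
    (α : ℕ → ℝ) (T : ℕ → X → X) (u : X) (n : ℕ) : X :=
  @Classical.epsilon X ⟨u⟩ (IsBrowderPoint W C α T u n)

/-- `tilde g n = n + g n`. -/
def tilde (g : ℕ → ℕ) (n : ℕ) : ℕ := n + g n

/-- `runMax g n = max {g i | i ≤ n}`. -/
def runMax (g : ℕ → ℕ) (n : ℕ) : ℕ := (Finset.range (n + 1)).sup g

noncomputable def psiStar (σ₄ θ₄ : ℕ → ℕ) (lim : ℝ) (K : ℕ) (k : ℕ) : ℕ :=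
  max (θ₄ (⌈4 * (K : ℝ) * ((k : ℝ) + 1) / lim⌉₊ - 1)) (σ₄ (4 * K * (k + 1) - 1))

noncomputable def sigmaStar (σ₁ σ₄ θ₄ : ℕ → ℕ) (lim : ℝ) (K : ℕ) (k : ℕ) : ℕ :=
  σ₁ (psiStar σ₄ θ₄ lim K (2 * k + 1) + ⌈Real.log (4 * (K : ℝ) * ((k : ℝ) + 1))⌉₊) + 1

/-- The rate of metastability of the Browder-type sequence for nonincreasing `(α n)`. -/
def omegaMono (M : ℕ) (k : ℕ) (g : ℕ → ℕ) : ℕ :=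
  (tilde g)^[M ^ 2 * (k + 1) ^ 2] 0

/-- The rate of metastability of the Browder-type sequence for `α n → 0`. -/
def omegaZero (σ₃ h : ℕ → ℕ) (M : ℕ) (k : ℕ) (g : ℕ → ℕ) : ℕ :=
  runMax σ₃ ((fun n => runMax h (tilde g (σ₃ n)))^[4 * M ^ 2 * (k + 1) ^ 2] 0)

/-- The function `h_{k,g}` built from a rate `S`. -/
def hkg (S : ℕ → ℕ) (k : ℕ) (g : ℕ → ℕ) (m : ℕ) : ℕ :=
  max (S (3 * k + 2)) m - m + g (max (S (3 * k + 2)) m)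

/-- `Φ(k, g) = max {S(3k+2), Ω(3k+2, h_{k,g})}`. -/
def phiStar (S : ℕ → ℕ) (Ω : ℕ → (ℕ → ℕ) → ℕ) (k : ℕ) (g : ℕ → ℕ) : ℕ :=
  max (S (3 * k + 2)) (Ω (3 * k + 2) (hkg S k g))

end HPPA

/-!
Write `S` for the pointwise limit of the maps `T n` on `C`; it exists because the resolvent
inequality makes `T n x` a Cauchy sequence, and it is nonexpansive and fixes `z`. The points
`y n` are Banach fixed points of the contractions `y ↦ α n • u + (1 - α n) • S y`.

*The two sequences approach each other.* The resolvent inequality, passed to the limit, bounds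
`d (T n (y n)) (S (y n))` by `α n * 2K * |lam n - l| / l`, and the contraction property bounds
`d (y n) (y (n+1))` by `2K * |α (n+1) - α n| / α n`. Hence `s n = d (x n) (y n)` satisfies
`s (n+1) ≤ (1 - α n) * s n + α n * b n` with `b n → 0` at an explicit rate, and divergence of
`∑ α n` forces `s n → 0` (`rate_of_recursion`).

*Metastability of `y`.* If `p` and `q` are the fixed points belonging to the parameters `s ≥ t`,
the CAT(0) inequality gives `d(p,q)² ≤ d(q,u)² - d(p,u)²`
(`IsAnchoredFixedPoint.sq_dist_add_sq_dist_le`). So the squared distance to the anchor `u` is a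
monotone function of the parameter and controls distances between fixed points. As it is bounded
by `M²`, among `B` consecutive increments along an iteration one is at most `M² / B`; this yields
both rates, the iteration running over indices when `α` is nonincreasing, and over auxiliary
parameters `1 / (n + 1)` when only `α n → 0`.

*Metastability of `x`* follows from the two facts by the triangle inequality.
-/

namespace HPPA

section Geometry

/-! ### Convex combinations and the CAT(0) inequality -/

variable {X : Type*} [MetricSpace X] {W : X → X → ℝ → X}

theorem IsWHyperbolic.apply_zero (hW : IsWHyperbolic W) (x y : X) : W x y 0 = x := by
  have h := hW.w1 x y x 0 (by simp)
  simp only [dist_self, mul_zero, zero_mul, add_zero] at h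
  exact (dist_le_zero.1 h).symm

theorem IsWHyperbolic.dist_left (hW : IsWHyperbolic W) (x y : X) {t : ℝ}
    (ht : t ∈ Set.Icc (0 : ℝ) 1) : dist x (W x y t) = t * dist x y := by
  have h := hW.w2 x y 0 (by simp) t ht
  rwa [hW.apply_zero, zero_sub, abs_neg, abs_of_nonneg ht.1] at h

theorem IsWHyperbolic.dist_right (hW : IsWHyperbolic W) (x y : X) {t : ℝ}
    (ht : t ∈ Set.Icc (0 : ℝ) 1) : dist y (W x y t) = (1 - t) * dist x y := by
  rw [hW.w3 x y t ht, hW.dist_left y x ⟨by linarith [ht.2], by linarith [ht.1]⟩, dist_comm]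

/-- Varying one endpoint of a convex combination contracts by its weight. -/
theorem IsWHyperbolic.dist_same_left (hW : IsWHyperbolic W) (u x y : X) {t : ℝ}
    (ht : t ∈ Set.Icc (0 : ℝ) 1) : dist (W u x t) (W u y t) ≤ t * dist x y := by
  simpa using hW.w4 u u x y t ht

/-- Midpoints are unique in a CAT(0) space. -/
theorem IsCAT0.eq_midpoint (hW : IsCAT0 W) {x y m : X} (hx : dist m x ≤ dist x y / 2)
    (hy : dist m y ≤ dist x y / 2) : m = W x y (1 / 2) := by
  have h := hW.cn x y m
  have h1 := pow_le_pow_left₀ dist_nonneg hx 2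
  have h2 := pow_le_pow_left₀ dist_nonneg hy 2
  have h3 : dist m (W x y (1 / 2)) ^ 2 ≤ 0 := by linarith
  exact dist_eq_zero.1 (pow_eq_zero_iff two_ne_zero |>.1 (le_antisymm h3 (sq_nonneg _)))

/-- The point with parameter `t ≤ 1/2` is the midpoint of `x` and the point with parameter
`2t`. -/
theorem IsCAT0.apply_eq_midpoint (hW : IsCAT0 W) (x y : X) {t : ℝ} (h0 : 0 ≤ t)
    (h1 : t ≤ 1 / 2) : W x y t = W x (W x y (2 * t)) (1 / 2) := by
  have ht : t ∈ Set.Icc (0 : ℝ) 1 := ⟨h0, by linarith⟩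
  have ht2 : 2 * t ∈ Set.Icc (0 : ℝ) 1 := ⟨by linarith, by linarith⟩
  apply hW.eq_midpoint
  · rw [dist_comm, hW.dist_left x y ht, hW.dist_left x y ht2]
    linarith
  · rw [hW.w2 x y t ht _ ht2, hW.dist_left x y ht2, show t - 2 * t = -t by ring, abs_neg,
      abs_of_nonneg h0]
    linarith

/-- The failure of the general CAT(0) inequality at the point with parameter `t`. -/
def cnDefect (W : X → X → ℝ → X) (x y z : X) (t : ℝ) : ℝ :=
  dist z (W x y t) ^ 2 - ((1 - t) * dist z x ^ 2 + t * dist z y ^ 2 - t * (1 - t) * dist x y ^ 2)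

theorem IsCAT0.cnDefect_le_half (hW : IsCAT0 W) (x y z : X) {t : ℝ} (h0 : 0 ≤ t)
    (h1 : t ≤ 1 / 2) : cnDefect W x y z t ≤ cnDefect W x y z (2 * t) / 2 := by
  have h := hW.cn x (W x y (2 * t)) z
  rw [← hW.apply_eq_midpoint x y h0 h1,
    hW.dist_left x y ⟨by linarith, by linarith⟩] at h
  unfold cnDefect
  nlinarith

theorem IsWHyperbolic.cnDefect_symm (hW : IsWHyperbolic W) (x y z : X) {t : ℝ}
    (ht : t ∈ Set.Icc (0 : ℝ) 1) : cnDefect W x y z t = cnDefect W y x z (1 - t) := by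
  unfold cnDefect
  rw [hW.w3 x y t ht, dist_comm y x]
  ring

/-- The Bruhat–Tits inequality for arbitrary weights. The defect at `t` is at most half the defect
at another parameter (`2t` or `2t - 1`), so a bounded defect cannot be positive. -/
theorem IsCAT0.sq_dist_le (hW : IsCAT0 W) (x y z : X) {t : ℝ} (ht : t ∈ Set.Icc (0 : ℝ) 1) :
    dist z (W x y t) ^ 2 ≤
      (1 - t) * dist z x ^ 2 + t * dist z y ^ 2 - t * (1 - t) * dist x y ^ 2 := by
  have key : ∀ n : ℕ, ∀ t ∈ Set.Icc (0 : ℝ) 1,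
      cnDefect W x y z t ≤ ((dist z x + dist z y) ^ 2 + dist x y ^ 2) * (1 / 2) ^ n := by
    intro n
    induction n with
    | zero =>
      rintro t ⟨h0, h1⟩
      have hle : dist z (W x y t) ≤ dist z x + dist z y := by
        have := hW.w1 x y z t ⟨h0, h1⟩
        nlinarith [dist_nonneg (x := z) (y := x), dist_nonneg (x := z) (y := y)]
      have hsq := pow_le_pow_left₀ dist_nonneg hle 2
      have h3 : 0 ≤ (1 - t) * dist z x ^ 2 := mul_nonneg (by linarith) (sq_nonneg _)
      have h4 : 0 ≤ t * dist z y ^ 2 := mul_nonneg h0 (sq_nonneg _)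
      have h5 : t * (1 - t) * dist x y ^ 2 ≤ 1 * dist x y ^ 2 :=
        mul_le_mul_of_nonneg_right (by nlinarith) (sq_nonneg _)
      unfold cnDefect
      rw [pow_zero]
      linarith
    | succ n ih =>
      rintro t ⟨h0, h1⟩
      rw [pow_succ (1 / 2 : ℝ) n]
      rcases le_total t (1 / 2) with h | h
      · have h2 := hW.cnDefect_le_half x y z h0 h
        have h3 := ih (2 * t) ⟨by linarith, by linarith⟩
        linarith
      · have h2 := hW.cnDefect_le_half y x z (t := 1 - t) (by linarith) (by linarith)
        have h3 := ih (2 * t - 1) ⟨by linarith, by linarith⟩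
        rw [hW.cnDefect_symm x y z ⟨by linarith, by linarith⟩,
          show 1 - (2 * t - 1) = 2 * (1 - t) by ring] at h3
        rw [hW.cnDefect_symm x y z ⟨h0, h1⟩]
        linarith
  have hlim : Tendsto (fun n : ℕ => ((dist z x + dist z y) ^ 2 + dist x y ^ 2) * (1 / 2 : ℝ) ^ n)
      atTop (𝓝 (((dist z x + dist z y) ^ 2 + dist x y ^ 2) * 0)) :=
    (tendsto_pow_atTop_nhds_zero_of_lt_one (by norm_num) (by norm_num)).const_mul _
  have h := ge_of_tendsto' hlim (fun n => key n t ht)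
  rw [mul_zero] at h
  unfold cnDefect at h
  linarith

/-- The quadrilateral inequality: the squared diagonals are bounded by the squared sides. It comes
from the Bruhat–Tits inequality at the midpoint of the diagonal `ac`, seen from `b` and `d`. -/
theorem IsCAT0.quadrilateral (hW : IsCAT0 W) (a b c d : X) :
    dist a c ^ 2 + dist b d ^ 2 ≤ dist a b ^ 2 + dist b c ^ 2 + dist c d ^ 2 + dist d a ^ 2 := by
  have h1 := hW.cn a c b
  have h2 := hW.cn a c d
  have h3 : dist b d ≤ dist b (W a c (1 / 2)) + dist d (W a c (1 / 2)) :=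
    dist_triangle_right _ _ _
  have h4 := pow_le_pow_left₀ dist_nonneg h3 2
  rw [dist_comm b a] at h1
  rw [dist_comm d c] at h2
  nlinarith [sq_nonneg (dist b (W a c (1 / 2)) - dist d (W a c (1 / 2)))]

end Geometry

section AnchoredFixedPoints

/-! ### Fixed points of the anchored contractions -/

variable {X : Type*} [MetricSpace X] {W : X → X → ℝ → X} {C : Set X} {S : X → X} {u : X}

/-- `p ∈ C` is a fixed point of the map `y ↦ s • u + (1 - s) • S y`. With `s = α n` and `S` the
pointwise limit of the maps `T n` this is, by definition, `IsBrowderPoint`. -/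
def IsAnchoredFixedPoint (W : X → X → ℝ → X) (C : Set X) (S : X → X) (u : X) (s : ℝ) (p : X) :
    Prop :=
  p ∈ C ∧ p = W u (S p) (1 - s)

/-- The squared distance to the anchor grows as the weight of the anchor decreases, and its
increment dominates the squared distance of the two fixed points. -/
theorem IsAnchoredFixedPoint.sq_dist_add_sq_dist_le (hW : IsCAT0 W)
    (hS : ∀ x ∈ C, ∀ y ∈ C, dist (S x) (S y) ≤ dist x y) {s t : ℝ} {p q : X}
    (hp : IsAnchoredFixedPoint W C S u s p) (hq : IsAnchoredFixedPoint W C S u t q)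
    (ht : 0 < t) (hts : t ≤ s) (hs : s ≤ 1) :
    dist p q ^ 2 + dist p u ^ 2 ≤ dist q u ^ 2 := by
  rcases eq_or_lt_of_le hs with rfl | hs1
  · have hpu : p = u := by rw [hp.2, sub_self, hW.apply_zero]
    rw [hpu, dist_self, dist_comm u q]
    simp
  have hsI : 1 - s ∈ Set.Icc (0 : ℝ) 1 := ⟨by linarith, by linarith⟩
  have htI : 1 - t ∈ Set.Icc (0 : ℝ) 1 := ⟨by linarith, by linarith⟩
  have h1 := hW.sq_dist_le u (S p) q hsI
  have h2 := hW.sq_dist_le u (S q) p htI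
  have hpu := hW.dist_left u (S p) hsI
  have hqu := hW.dist_left u (S q) htI
  have hpS := hW.dist_right u (S p) hsI
  have hqS := hW.dist_right u (S q) htI
  rw [← hp.2] at h1 hpu hpS
  rw [← hq.2] at h2 hqu hqS
  have h3 := hW.quadrilateral p q (S q) (S p)
  have h4 := pow_le_pow_left₀ dist_nonneg (hS q hq.1 p hp.1) 2
  rw [dist_comm (S p) p] at hpS
  rw [dist_comm (S p) p, hpS, dist_comm q (S q), hqS] at h3
  rw [dist_comm q p] at h1 h4
  rw [dist_comm p u] at h2 ⊢
  rw [dist_comm q u] at h1 ⊢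
  -- the two convexity estimates, weighted so that the diagonals `d(p, S q)` and `d(q, S p)` of
  -- the quadrilateral inequality appear with equal coefficients
  have key : (s + t - 2 * s * t) * dist p q ^ 2 ≤ (s - t) * (dist u q ^ 2 - dist u p ^ 2) := by
    rw [hpu] at h2 ⊢
    rw [hqu] at h1 ⊢
    simp only [mul_pow] at *
    have h5 := mul_le_mul_of_nonneg_left h1 htI.1
    have h6 := mul_le_mul_of_nonneg_left h2 hsI.1
    have h7 := mul_le_mul_of_nonneg_left (h3.trans (add_le_add_left (add_le_add_right h4 _) _))
      (mul_nonneg hsI.1 htI.1)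
    linarith
  have hpos : 0 < s + t - 2 * s * t := by nlinarith
  rcases eq_or_lt_of_le hts with rfl | hlt
  · rw [sub_self, zero_mul] at key
    have hpq : p = q := dist_eq_zero.1 (pow_eq_zero_iff two_ne_zero |>.1
      (le_antisymm (nonpos_of_mul_nonpos_right key hpos) (sq_nonneg (dist p q))))
    simp [hpq]
  · have h5 : 0 ≤ dist u q ^ 2 - dist u p ^ 2 :=
      nonneg_of_mul_nonneg_right ((mul_nonneg hpos.le (sq_nonneg _)).trans key) (by linarith)
    have h6 : (s - t) * (dist u q ^ 2 - dist u p ^ 2) ≤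
        (s + t - 2 * s * t) * (dist u q ^ 2 - dist u p ^ 2) :=
      mul_le_mul_of_nonneg_right (by nlinarith) h5
    linarith [le_of_mul_le_mul_left (key.trans h6) hpos]

theorem IsAnchoredFixedPoint.unique (hW : IsCAT0 W)
    (hS : ∀ x ∈ C, ∀ y ∈ C, dist (S x) (S y) ≤ dist x y) {s : ℝ} {p q : X}
    (hp : IsAnchoredFixedPoint W C S u s p) (hq : IsAnchoredFixedPoint W C S u s q)
    (hs : s ∈ Set.Ioc (0 : ℝ) 1) : p = q := by
  have h1 := hp.sq_dist_add_sq_dist_le hW hS hq hs.1 le_rfl hs.2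
  have h2 := hq.sq_dist_add_sq_dist_le hW hS hp hs.1 le_rfl hs.2
  rw [dist_comm q p] at h2
  exact dist_eq_zero.1 (pow_eq_zero_iff two_ne_zero |>.1
    (le_antisymm (by linarith) (sq_nonneg (dist p q))))

theorem exists_isAnchoredFixedPoint [CompleteSpace X] (hW : IsWHyperbolic W) (hCcl : IsClosed C)
    (hCconv : IsWConvex W C) (hSmaps : Set.MapsTo S C C)
    (hS : ∀ x ∈ C, ∀ y ∈ C, dist (S x) (S y) ≤ dist x y) (hu : u ∈ C) {s : ℝ}
    (hs : s ∈ Set.Ioc (0 : ℝ) 1) : ∃ p, IsAnchoredFixedPoint W C S u s p := by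
  have hsI : 1 - s ∈ Set.Icc (0 : ℝ) 1 := ⟨by linarith [hs.2], by linarith [hs.1]⟩
  have hmaps : Set.MapsTo (fun y => W u (S y) (1 - s)) C C :=
    fun y hy => hCconv u hu _ (hSmaps hy) _ hsI
  have hcontr : ContractingWith ⟨1 - s, hsI.1⟩ (hmaps.restrict _ C C) := by
    refine ⟨NNReal.coe_lt_coe.1 (by change 1 - s < 1; linarith [hs.1]), LipschitzWith.of_dist_le_mul ?_⟩
    rintro ⟨x, hx⟩ ⟨y, hy⟩
    exact (hW.dist_same_left u (S x) (S y) hsI).trans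
      (mul_le_mul_of_nonneg_left (hS x hx y hy) hsI.1)
  obtain ⟨p, hpC, hp, -⟩ := hcontr.exists_fixedPoint' hCcl.isComplete hmaps hu (edist_ne_top _ _)
  exact ⟨p, hpC, hp.symm⟩

/-- Fixed points whose parameters lie between `c'` and `c` are as close as the squared distances
to the anchor at `c'` and `c` allow. -/
theorem IsAnchoredFixedPoint.sq_dist_le_of_mem_Icc (hW : IsCAT0 W)
    (hS : ∀ x ∈ C, ∀ y ∈ C, dist (S x) (S y) ≤ dist x y) {c c' s t : ℝ} {a b p q : X}
    (ha : IsAnchoredFixedPoint W C S u c a) (hb : IsAnchoredFixedPoint W C S u c' b)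
    (hp : IsAnchoredFixedPoint W C S u s p) (hq : IsAnchoredFixedPoint W C S u t q)
    (hc' : 0 < c') (hc : c ≤ 1) (hs : s ∈ Set.Icc c' c) (ht : t ∈ Set.Icc c' c) :
    dist p q ^ 2 ≤ dist b u ^ 2 - dist a u ^ 2 := by
  wlog hts : t ≤ s generalizing s t p q
  · rw [dist_comm]
    exact this hq hp ht hs (le_of_not_ge hts)
  have h1 := hp.sq_dist_add_sq_dist_le hW hS hq (hc'.trans_le ht.1) hts (hs.2.trans hc)
  have h2 := hq.sq_dist_add_sq_dist_le hW hS hb hc' ht.1 (ht.2.trans hc)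
  have h3 := ha.sq_dist_add_sq_dist_le hW hS hp (hc'.trans_le hs.1) hs.2 hc
  linarith [sq_nonneg (dist q b), sq_nonneg (dist a p)]

theorem IsAnchoredFixedPoint.dist_le (hW : IsWHyperbolic W)
    (hS : ∀ x ∈ C, ∀ y ∈ C, dist (S x) (S y) ≤ dist x y) {z : X} (hz : z ∈ C) (hSz : S z = z)
    {s : ℝ} (hs : s ∈ Set.Ioc (0 : ℝ) 1) {p : X} (hp : IsAnchoredFixedPoint W C S u s p) :
    dist z p ≤ dist z u := by
  have h := hW.w1 u (S p) z (1 - s) ⟨by linarith [hs.2], by linarith [hs.1]⟩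
  rw [← hp.2] at h
  have h2 := hS z hz p hp.1
  rw [hSz] at h2
  have h3 := mul_le_mul_of_nonneg_left h2 (show 0 ≤ 1 - s by linarith [hs.2])
  exact le_of_mul_le_mul_left (by linarith) hs.1

end AnchoredFixedPoints

section Metastability

/-! ### Metastability -/

variable {X : Type*} [MetricSpace X]

/-- A bounded nonnegative finite sequence has a small increment. -/
theorem exists_sub_le_div {a : ℕ → ℝ} {L : ℝ} {B : ℕ} (hB : 0 < B) (h0 : 0 ≤ a 0)
    (hL : a B ≤ L) : ∃ i < B, a (i + 1) - a i ≤ L / B := by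
  by_contra! h
  have h1 : ∑ _i ∈ Finset.range B, L / B < ∑ i ∈ Finset.range B, (a (i + 1) - a i) :=
    Finset.sum_lt_sum_of_nonempty (Finset.nonempty_range_iff.2 hB.ne')
      fun i hi => h i (Finset.mem_range.1 hi)
  rw [Finset.sum_range_sub, Finset.sum_const, Finset.card_range, nsmul_eq_mul,
    mul_div_cancel₀ _ (Nat.cast_ne_zero.2 hB.ne')] at h1
  linarith

theorem IsRateOfMetastability.cauchySeq {x : ℕ → X} {Ω : ℕ → (ℕ → ℕ) → ℕ}
    (h : IsRateOfMetastability x Ω) : CauchySeq x := by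
  rw [Metric.cauchySeq_iff]
  by_contra! hx
  obtain ⟨ε, hε, hx⟩ := hx
  choose m hm n hn hmn using hx
  obtain ⟨k, hk⟩ := exists_nat_one_div_lt hε
  -- a counterfunction long enough to reach the witnesses against the Cauchy property
  obtain ⟨N, -, hN⟩ := h k (fun N => m N + n N)
  have := hN (m N) ⟨hm N, by omega⟩ (n N) ⟨hn N, by omega⟩
  linarith [hmn N]

/-- A sequence inherits metastability from a sequence it approaches with a known rate. -/
theorem IsRateOfMetastability.of_dist_tendsto_zero {x y : ℕ → X} {R : ℕ → ℕ}
    {Ω : ℕ → (ℕ → ℕ) → ℕ} (hy : IsRateOfMetastability y Ω)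
    (hxy : IsRateOfConvergence (fun n => dist (x n) (y n)) 0 R) :
    IsRateOfMetastability x (phiStar R Ω) := by
  intro k g
  obtain ⟨N, hN, hst⟩ := hy (3 * k + 2) (hkg R k g)
  have hclose : ∀ i, R (3 * k + 2) ≤ i → dist (x i) (y i) ≤ 1 / (3 * ((k : ℝ) + 1)) := by
    intro i hi
    have := hxy (3 * k + 2) i hi
    rw [Real.dist_0_eq_abs, abs_of_nonneg dist_nonneg] at this
    convert this using 2
    push_cast
    ring
  refine ⟨max (R (3 * k + 2)) N, max_le_max le_rfl hN, ?_⟩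
  have hmem : ∀ i ∈ Set.Icc (max (R (3 * k + 2)) N)
      (max (R (3 * k + 2)) N + g (max (R (3 * k + 2)) N)),
      R (3 * k + 2) ≤ i ∧ i ∈ Set.Icc N (N + hkg R k g N) := by
    rintro i ⟨hi1, hi2⟩
    have h1 := le_max_left (R (3 * k + 2)) N
    have h2 := le_max_right (R (3 * k + 2)) N
    unfold hkg
    exact ⟨h1.trans hi1, h2.trans hi1, by omega⟩
  intro i hi j hj
  obtain ⟨hi1, hi2⟩ := hmem i hi
  obtain ⟨hj1, hj2⟩ := hmem j hj
  have h1 := hclose i hi1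
  have h2 := hclose j hj1
  have h3 : dist (y i) (y j) ≤ 1 / (3 * ((k : ℝ) + 1)) := by
    convert hst i hi2 j hj2 using 2
    push_cast
    ring
  have h4 : 1 / ((k : ℝ) + 1) = 3 * (1 / (3 * ((k : ℝ) + 1))) := by
    field_simp
  have h5 := dist_triangle4 (x i) (y i) (y j) (x j)
  rw [dist_comm (y j)] at h5
  linarith

theorem le_runMax (g : ℕ → ℕ) {i n : ℕ} (h : i ≤ n) : g i ≤ runMax g n :=
  Finset.le_sup (f := g) (Finset.mem_range.2 (Nat.lt_succ_of_le h))

variable {W : X → X → ℝ → X} {C : Set X} {S : X → X} {u : X} {α : ℕ → ℝ} {y : ℕ → X} {M : ℕ}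

/-- For nonincreasing `α` the squared distances `d(y n, u)²` are nondecreasing and bounded by `M²`,
so their increment over some interval `[N, N + g N]`, with `N` an iterate of `tilde g`, is small. -/
theorem isRateOfMetastability_omegaMono (hW : IsCAT0 W)
    (hS : ∀ x ∈ C, ∀ y ∈ C, dist (S x) (S y) ≤ dist x y) (hα : ∀ n, α n ∈ Set.Ioc (0 : ℝ) 1)
    (hy : ∀ n, IsAnchoredFixedPoint W C S u (α n) (y n)) (hM : 1 ≤ M)
    (hyM : ∀ n, dist (y n) u ≤ M) (hanti : Antitone α) :
    IsRateOfMetastability y (omegaMono M) := by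
  intro k g
  obtain ⟨i, hi, hle⟩ := exists_sub_le_div
    (a := fun i => dist (y ((tilde g)^[i] 0)) u ^ 2) (L := (M : ℝ) ^ 2)
    (B := M ^ 2 * (k + 1) ^ 2) (by positivity) (sq_nonneg _)
    (pow_le_pow_left₀ dist_nonneg (hyM _) 2)
  have hself : ∀ n, n ≤ tilde g n := fun n => Nat.le_add_right _ _
  refine ⟨(tilde g)^[i] 0, Function.monotone_iterate_of_id_le hself hi.le 0, ?_⟩
  set N := (tilde g)^[i] 0
  simp only [Function.iterate_succ_apply'] at hle
  intro m hm n hn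
  have hbd := (hy N).sq_dist_le_of_mem_Icc hW hS (hy (N + g N)) (hy m) (hy n)
    (hα _).1 (hα _).2 ⟨hanti hm.2, hanti hm.1⟩ ⟨hanti hn.2, hanti hn.1⟩
  have hM0 : (M : ℝ) ≠ 0 := Nat.cast_ne_zero.2 (by omega)
  have hB : (M : ℝ) ^ 2 / ((M ^ 2 * (k + 1) ^ 2 : ℕ) : ℝ) = (1 / ((k : ℝ) + 1)) ^ 2 := by
    push_cast
    field_simp
  rw [hB] at hle
  exact le_of_sq_le_sq (hbd.trans hle) (by positivity)

/-- Here the monotone bounded sequence is `d(Y n, u)²`, for the auxiliary fixed points `Y n` with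
parameter `1 / (n + 1)`, along the iterates of `G n = runMax h (tilde g (σ₃ n))`. On the interval
starting at `σ₃ n` the parameters `α m` lie between `1 / (G n + 1)` and `1 / (n + 1)`, so the
distances of the points `y m` are controlled by the increment from `Y n` to `Y (G n)`. -/
theorem isRateOfMetastability_omegaZero [CompleteSpace X] (hW : IsCAT0 W) (hCcl : IsClosed C)
    (hCconv : IsWConvex W C) (hSmaps : Set.MapsTo S C C)
    (hS : ∀ x ∈ C, ∀ y ∈ C, dist (S x) (S y) ≤ dist x y) (hu : u ∈ C)
    (hα : ∀ n, α n ∈ Set.Ioc (0 : ℝ) 1)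
    (hy : ∀ n, IsAnchoredFixedPoint W C S u (α n) (y n)) (hM : 1 ≤ M)
    (hyM : ∀ n, dist (y n) u ≤ M) {σ₃ h : ℕ → ℕ} (hσ₃ : IsRateOfConvergence α 0 σ₃)
    (hh : ∀ n, 1 / ((h n : ℝ) + 1) ≤ α n) :
    IsRateOfMetastability y (omegaZero σ₃ h M) := by
  intro k g
  have hle_of : ∀ n m, σ₃ n ≤ m → α m ≤ 1 / ((n : ℝ) + 1) := by
    intro n m hm
    have := hσ₃ n m hm
    rwa [Real.dist_0_eq_abs, abs_of_pos (hα m).1] at this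
  have hle1 : ∀ n : ℕ, 1 / ((n : ℝ) + 1) ∈ Set.Ioc (0 : ℝ) 1 := fun n =>
    ⟨by positivity, by rw [div_le_one (by positivity)]; linarith [n.cast_nonneg (α := ℝ)]⟩
  have hex : ∀ n : ℕ, ∃ p, IsAnchoredFixedPoint W C S u (1 / ((n : ℝ) + 1)) p := fun n =>
    exists_isAnchoredFixedPoint hW.toIsWHyperbolic hCcl hCconv hSmaps hS hu (hle1 n)
  choose Y hY using hex
  -- the bound `M` passes to the auxiliary points, as some `α m` is below each parameter
  have hYM : ∀ n, dist (Y n) u ≤ M := by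
    intro n
    have h1 := (hY n).sq_dist_add_sq_dist_le hW hS (hy (σ₃ n)) (hα _).1 (hle_of n _ le_rfl)
      (hle1 n).2
    refine le_trans (le_of_sq_le_sq ?_ dist_nonneg) (hyM (σ₃ n))
    linarith [sq_nonneg (dist (Y n) (y (σ₃ n)))]
  set G : ℕ → ℕ := fun n => runMax h (tilde g (σ₃ n)) with hG
  have hGle : ∀ n m, m ≤ σ₃ n + g (σ₃ n) → 1 / ((G n : ℝ) + 1) ≤ α m := by
    intro n m hm
    refine le_trans ?_ (hh m)
    have : (h m : ℝ) ≤ G n := Nat.cast_le.2 (le_runMax h hm)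
    gcongr
  have hself : ∀ n, n ≤ G n := by
    intro n
    have h1 := (hGle n (σ₃ n) (Nat.le_add_right _ _)).trans (hle_of n _ le_rfl)
    rw [one_div_le_one_div (by positivity) (by positivity)] at h1
    exact_mod_cast (add_le_add_iff_right (1 : ℝ)).1 h1
  obtain ⟨i, hi, hle⟩ := exists_sub_le_div
    (a := fun i => dist (Y (G^[i] 0)) u ^ 2) (L := (M : ℝ) ^ 2)
    (B := 4 * M ^ 2 * (k + 1) ^ 2) (by positivity) (sq_nonneg _)
    (pow_le_pow_left₀ dist_nonneg (hYM _) 2)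
  refine ⟨σ₃ (G^[i] 0), le_runMax σ₃ (Function.monotone_iterate_of_id_le hself hi.le 0), ?_⟩
  set n := G^[i] 0
  simp only [Function.iterate_succ_apply'] at hle
  intro p hp q hq
  have hbd := (hY n).sq_dist_le_of_mem_Icc hW hS (hY (G n)) (hy p) (hy q) (hle1 _).1 (hle1 _).2
    ⟨hGle n p hp.2, hle_of n p hp.1⟩ ⟨hGle n q hq.2, hle_of n q hq.1⟩
  have hM0 : (M : ℝ) ≠ 0 := Nat.cast_ne_zero.2 (by omega)
  have hB : (M : ℝ) ^ 2 / ((4 * M ^ 2 * (k + 1) ^ 2 : ℕ) : ℝ) = (1 / ((k : ℝ) + 1)) ^ 2 / 4 := by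
    push_cast
    field_simp
  rw [hB] at hle
  refine le_of_sq_le_sq (hbd.trans (hle.trans ?_)) (by positivity)
  linarith [sq_nonneg (1 / ((k : ℝ) + 1))]

end Metastability

/-! ### Recursive inequalities -/

/-- A quantitative form of Xu's lemma on `s (n+1) ≤ (1 - α n) s n + α n b n`, the perturbation
being at most `1 / (k + 1)` from `ψ k` on. -/
theorem rate_of_recursion {s α b : ℕ → ℝ} {L : ℝ} {σ ψ : ℕ → ℕ} (hL : 0 < L)
    (hs : ∀ n, s n ≤ L) (hα : ∀ n, α n ∈ Set.Ioc (0 : ℝ) 1) (hσ : IsRateOfDivergence α σ)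
    (hrec : ∀ n, s (n + 1) ≤ (1 - α n) * s n + α n * b n)
    (hb : ∀ k n, ψ k ≤ n → b n ≤ 1 / ((k : ℝ) + 1)) (k n : ℕ)
    (hn : σ (ψ (2 * k + 1) + ⌈Real.log (2 * L * ((k : ℝ) + 1))⌉₊) + 1 ≤ n) :
    s n ≤ 1 / ((k : ℝ) + 1) := by
  set N := ψ (2 * k + 1)
  set P := ⌈Real.log (2 * L * ((k : ℝ) + 1))⌉₊
  have hk : (0 : ℝ) < (k : ℝ) + 1 := by positivity
  have hsum_le : ∀ m, ∑ i ∈ Finset.range m, α i ≤ m := by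
    intro m
    simpa using Finset.sum_le_card_nsmul (Finset.range m) α 1 fun i _ => (hα i).2
  have hsum : ((N + P : ℕ) : ℝ) ≤ ∑ i ∈ Finset.range n, α i :=
    (hσ (N + P)).trans (Finset.sum_le_sum_of_subset_of_nonneg (Finset.range_mono hn)
      fun i _ _ => (hα i).1.le)
  have hNn : N ≤ n := by
    have : N + P ≤ n := Nat.cast_le.1 (hsum.trans (hsum_le n))
    omega
  -- the excess over `1 / (2 (k + 1))` decays like `exp (-∑ α)` from `N` on
  have hdecay : ∀ m, s (N + m) - 1 / (2 * ((k : ℝ) + 1)) ≤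
      L * Real.exp (-∑ i ∈ Finset.range m, α (N + i)) := by
    intro m
    induction m with
    | zero =>
      have : 0 < 1 / (2 * ((k : ℝ) + 1)) := by positivity
      simp only [add_zero, Finset.range_zero, Finset.sum_empty, neg_zero, Real.exp_zero, mul_one]
      linarith [hs N]
    | succ m ih =>
      have h1 := hrec (N + m)
      have h2 : b (N + m) ≤ 1 / (2 * ((k : ℝ) + 1)) := by
        convert hb (2 * k + 1) (N + m) (Nat.le_add_right _ _) using 2
        push_cast
        ring
      have h3 := mul_le_mul_of_nonneg_left h2 (hα (N + m)).1.le
      have h4 := mul_le_mul_of_nonneg_left ih (show 0 ≤ 1 - α (N + m) by linarith [(hα (N + m)).2])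
      have h5 : 1 - α (N + m) ≤ Real.exp (-α (N + m)) := Real.one_sub_le_exp_neg _
      have h6 := mul_le_mul_of_nonneg_right h5
        (show 0 ≤ L * Real.exp (-∑ i ∈ Finset.range m, α (N + i)) by positivity)
      rw [Finset.sum_range_succ, neg_add, Real.exp_add, ← add_assoc]
      linarith
  have h1 := hdecay (n - N)
  rw [Nat.add_sub_cancel' hNn] at h1
  have h2 : Real.log (2 * L * ((k : ℝ) + 1)) ≤ ∑ i ∈ Finset.range (n - N), α (N + i) := by
    have h3 := Finset.sum_range_add α N (n - N)
    rw [Nat.add_sub_cancel' hNn] at h3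
    have h4 : Real.log (2 * L * ((k : ℝ) + 1)) ≤ P := Nat.le_ceil _
    push_cast at hsum
    linarith [hsum_le N]
  have h3 : L * Real.exp (-∑ i ∈ Finset.range (n - N), α (N + i)) ≤
      L * Real.exp (-Real.log (2 * L * ((k : ℝ) + 1))) := by gcongr
  rw [Real.exp_neg (Real.log _), Real.exp_log (by positivity)] at h3
  have h4 : L * (2 * L * ((k : ℝ) + 1))⁻¹ = 1 / (2 * ((k : ℝ) + 1)) := by
    field_simp
  have h5 : 1 / ((k : ℝ) + 1) = 1 / (2 * ((k : ℝ) + 1)) + 1 / (2 * ((k : ℝ) + 1)) := by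
    field_simp
    norm_num
  linarith

theorem IsRateOfConvergence.tendsto {X : Type*} [MetricSpace X] {x : ℕ → X} {a : X} {φ : ℕ → ℕ}
    (h : IsRateOfConvergence x a φ) : Tendsto x atTop (𝓝 a) := by
  rw [Metric.tendsto_atTop]
  intro ε hε
  obtain ⟨k, hk⟩ := exists_nat_one_div_lt hε
  exact ⟨φ k, fun n hn => (h k n hn).trans_lt hk⟩

section ResolventFamilies

/-! ### The limit of a resolvent-like family -/

variable {X : Type*} [MetricSpace X] {W : X → X → ℝ → X} {C : Set X} {T : ℕ → X → X}
  {lam : ℕ → ℝ} {l : ℝ} {z : X}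

theorem tendsto_limitMap [CompleteSpace X]
    (hTnonexp : ∀ n, ∀ x ∈ C, ∀ y ∈ C, dist (T n x) (T n y) ≤ dist x y)
    (hzC : z ∈ C) (hz : ∀ n, T n z = z) (hRes : IsResolventLike C T lam) (hl : 0 < l)
    (hlim : Tendsto lam atTop (𝓝 l)) {x : X} (hx : x ∈ C) :
    Tendsto (fun n => T n x) atTop (𝓝 (limitMap T x)) := by
  have hbd : ∀ n, dist x (T n x) ≤ 2 * dist x z := by
    intro n
    have h1 := hTnonexp n z hzC x hx
    rw [hz n, dist_comm z x] at h1
    linarith [dist_triangle x z (T n x)]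
  have hcauchy : CauchySeq fun n => T n x := by
    rw [cauchySeq_iff_tendsto_dist_atTop_0]
    have hlam1 : Tendsto (fun n : ℕ × ℕ => lam n.1) atTop (𝓝 l) :=
      hlim.comp (by rw [← prod_atTop_atTop_eq]; exact tendsto_fst)
    have hlam2 : Tendsto (fun n : ℕ × ℕ => lam n.2) atTop (𝓝 l) :=
      hlim.comp (by rw [← prod_atTop_atTop_eq]; exact tendsto_snd)
    have h0 : Tendsto (fun n : ℕ × ℕ => |1 - lam n.2 / lam n.1| * (2 * dist x z)) atTop (𝓝 0) := by
      have := (((hlam2.div hlam1 hl.ne').const_sub 1).abs).mul_const (2 * dist x z)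
      simpa [div_self hl.ne'] using this
    exact squeeze_zero (fun _ => dist_nonneg) (fun n => (hRes n.1 n.2 x hx).trans
      (mul_le_mul_of_nonneg_left (hbd n.1) (abs_nonneg _))) h0
  exact tendsto_nhds_limUnder (cauchySeq_tendsto_of_complete hcauchy)

/-- The resolvent inequality with one of the two indices sent to infinity. -/
theorem dist_limitMap_le (hRes : IsResolventLike C T lam) (hl : 0 < l)
    (hlim : Tendsto lam atTop (𝓝 l)) {x : X} (hx : x ∈ C)
    (hTx : Tendsto (fun n => T n x) atTop (𝓝 (limitMap T x))) (n : ℕ) :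
    dist (T n x) (limitMap T x) ≤ |lam n - l| / l * dist x (limitMap T x) := by
  have h1 : Tendsto (fun m => dist (T m x) (T n x)) atTop (𝓝 (dist (limitMap T x) (T n x))) :=
    hTx.dist tendsto_const_nhds
  have h2 : Tendsto (fun m => |1 - lam n / lam m| * dist x (T m x)) atTop
      (𝓝 (|1 - lam n / l| * dist x (limitMap T x))) :=
    (((tendsto_const_nhds.div hlim hl.ne').const_sub 1).abs).mul (tendsto_const_nhds.dist hTx)
  have h3 := le_of_tendsto_of_tendsto' h1 h2 fun m => hRes m n x hx
  have h4 : |1 - lam n / l| = |lam n - l| / l := by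
    rw [abs_sub_comm, ← abs_of_pos hl, ← abs_div, abs_of_pos hl]
    congr 1
    field_simp
  rwa [h4, dist_comm] at h3

end ResolventFamilies

/-! ### The distance between the two iterations -/

theorem hppa_mem {X : Type*} {W : X → X → ℝ → X} {C : Set X} {T : ℕ → X → X} {α : ℕ → ℝ}
    {u x₀ : X} (hCconv : IsWConvex W C) (hTmaps : ∀ n, Set.MapsTo (T n) C C)
    (hα : ∀ n, α n ∈ Set.Ioc (0 : ℝ) 1) (hu : u ∈ C) (hx₀ : x₀ ∈ C) (n : ℕ) :
    hppa W α T u x₀ n ∈ C := by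
  induction n with
  | zero => exact hx₀
  | succ n ih =>
    exact hCconv u hu _ (hTmaps n ih) _ ⟨by linarith [(hα n).2], by linarith [(hα n).1]⟩

section Approach

variable {X : Type*} [MetricSpace X] {W : X → X → ℝ → X} {C : Set X} {T : ℕ → X → X}
  {S : X → X} {α : ℕ → ℝ} {u x₀ z : X}

theorem dist_hppa_le (hW : IsWHyperbolic W) (hCconv : IsWConvex W C)
    (hTmaps : ∀ n, Set.MapsTo (T n) C C)
    (hTnonexp : ∀ n, ∀ x ∈ C, ∀ y ∈ C, dist (T n x) (T n y) ≤ dist x y)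
    (hzC : z ∈ C) (hz : ∀ n, T n z = z) (hα : ∀ n, α n ∈ Set.Ioc (0 : ℝ) 1) (hu : u ∈ C)
    (hx₀ : x₀ ∈ C) {K : ℝ} (hKx : dist x₀ z ≤ K) (hKu : dist u z ≤ K) (n : ℕ) :
    dist z (hppa W α T u x₀ n) ≤ K := by
  induction n with
  | zero => rwa [dist_comm] at hKx
  | succ n ih =>
    have h1 := hW.w1 u (T n (hppa W α T u x₀ n)) z (1 - α n)
      ⟨by linarith [(hα n).2], by linarith [(hα n).1]⟩
    have h2 := hTnonexp n z hzC _ (hppa_mem hCconv hTmaps hα hu hx₀ n)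
    rw [hz n] at h2
    rw [dist_comm] at hKu
    have h3 := mul_le_mul_of_nonneg_left (h2.trans ih) (show 0 ≤ 1 - α n by linarith [(hα n).2])
    have h4 := mul_le_mul_of_nonneg_left hKu (hα n).1.le
    change dist z (W u (T n (hppa W α T u x₀ n)) (1 - α n)) ≤ K
    linarith

/-- Fixed points with nearby parameters `s`, `t` are close. The factor `s` on the left is what the
contraction constant `1 - s` leaves of `d(p, q)`. -/
theorem IsAnchoredFixedPoint.mul_dist_le (hW : IsWHyperbolic W)
    (hS : ∀ x ∈ C, ∀ y ∈ C, dist (S x) (S y) ≤ dist x y) {s t : ℝ} {p q : X}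
    (hs : s ∈ Set.Ioc (0 : ℝ) 1) (ht : t ∈ Set.Ioc (0 : ℝ) 1)
    (hp : IsAnchoredFixedPoint W C S u s p) (hq : IsAnchoredFixedPoint W C S u t q) :
    s * dist p q ≤ |t - s| * dist u (S q) := by
  have hsI : 1 - s ∈ Set.Icc (0 : ℝ) 1 := ⟨by linarith [hs.2], by linarith [hs.1]⟩
  have htI : 1 - t ∈ Set.Icc (0 : ℝ) 1 := ⟨by linarith [ht.2], by linarith [ht.1]⟩
  have h1 := hW.dist_same_left u (S p) (S q) hsI
  have h2 := hW.w2 u (S q) _ hsI _ htI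
  rw [← hp.2] at h1
  rw [← hq.2, show 1 - s - (1 - t) = t - s by ring] at h2
  have h3 := mul_le_mul_of_nonneg_left (hS p hp.1 q hq.1) hsI.1
  linarith [dist_triangle p (W u (S q) (1 - s)) q]

/-- The recursive inequality for the distance between the iteration and the fixed points `y n`. -/
theorem dist_hppa_succ_le (hW : IsWHyperbolic W) (hCconv : IsWConvex W C)
    (hTmaps : ∀ n, Set.MapsTo (T n) C C)
    (hTnonexp : ∀ n, ∀ x ∈ C, ∀ y ∈ C, dist (T n x) (T n y) ≤ dist x y)
    (hS : ∀ x ∈ C, ∀ y ∈ C, dist (S x) (S y) ≤ dist x y)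
    (hα : ∀ n, α n ∈ Set.Ioc (0 : ℝ) 1) (hu : u ∈ C) (hx₀ : x₀ ∈ C) {y : ℕ → X}
    (hy : ∀ n, IsAnchoredFixedPoint W C S u (α n) (y n)) {L : ℝ}
    (hL : ∀ n, dist u (S (y n)) ≤ L) {n : ℕ} {r : ℝ} (hr : 0 ≤ r)
    (hTS : dist (T n (y n)) (S (y n)) ≤ r * dist (y n) (S (y n))) :
    dist (hppa W α T u x₀ (n + 1)) (y (n + 1)) ≤
      (1 - α n) * dist (hppa W α T u x₀ n) (y n) +
        α n * (L * r + L * (|α (n + 1) - α n| / α n ^ 2)) := by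
  obtain ⟨hα0, hα1⟩ := hα n
  have hI : 1 - α n ∈ Set.Icc (0 : ℝ) 1 := ⟨by linarith, by linarith⟩
  set x := hppa W α T u x₀ n
  have hx : x ∈ C := hppa_mem hCconv hTmaps hα hu hx₀ n
  have h1 : dist (hppa W α T u x₀ (n + 1)) (y n) ≤ (1 - α n) * dist (T n x) (S (y n)) := by
    have h := hW.dist_same_left u (T n x) (S (y n)) hI
    rwa [← (hy n).2] at h
  have h2 : dist (T n x) (S (y n)) ≤ dist x (y n) + dist (T n (y n)) (S (y n)) :=
    (dist_triangle _ (T n (y n)) _).trans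
      (add_le_add_left (hTnonexp n x hx (y n) (hy n).1) _)
  have h3 : dist (y n) (S (y n)) = α n * dist u (S (y n)) := by
    have h := hW.dist_right u (S (y n)) hI
    rwa [← (hy n).2, sub_sub_cancel, dist_comm] at h
  have h4 : dist (T n (y n)) (S (y n)) ≤ α n * (L * r) := by
    rw [h3] at hTS
    have := mul_le_mul_of_nonneg_left (hL n) (mul_nonneg hr hα0.le)
    linarith
  have h5 : dist (y n) (y (n + 1)) ≤ α n * (L * (|α (n + 1) - α n| / α n ^ 2)) := by
    have h := (hy n).mul_dist_le hW hS (hα n) (hα (n + 1)) (hy (n + 1))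
    have h' := h.trans (mul_le_mul_of_nonneg_left (hL (n + 1)) (abs_nonneg _))
    rw [mul_comm, ← le_div_iff₀ hα0] at h'
    refine h'.trans (le_of_eq ?_)
    field_simp
  have h6 := mul_le_mul_of_nonneg_left (h2.trans (add_le_add_right h4 _)) hI.1
  have h7 : (1 - α n) * (α n * (L * r)) ≤ α n * (L * r) :=
    mul_le_of_le_one_left (dist_nonneg.trans h4) hI.2
  linarith [dist_triangle (hppa W α T u x₀ (n + 1)) (y n) (y (n + 1))]

end Approach

section Rates

/-! ### The explicit rate -/

theorem IsRateOfConvergence.dist_le_one_div {X : Type*} [MetricSpace X] {x : ℕ → X} {a : X}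
    {φ : ℕ → ℕ} (h : IsRateOfConvergence x a φ) {m n : ℕ} (hm : 0 < m) (hn : φ (m - 1) ≤ n) :
    dist (x n) a ≤ 1 / (m : ℝ) := by
  convert h (m - 1) n hn using 2
  exact_mod_cast (Nat.sub_add_cancel hm).symm

theorem perturbation_le_of_psiStar_le {lam α : ℕ → ℝ} {l : ℝ} (hl : 0 < l) {θ₄ σ₄ : ℕ → ℕ}
    (hθ₄ : IsRateOfConvergence lam l θ₄)
    (hσ₄ : IsRateOfConvergence (fun n => |α (n + 1) - α n| / (α n) ^ 2) 0 σ₄)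
    {K : ℕ} (hK : 1 ≤ K) (k n : ℕ) (hn : psiStar σ₄ θ₄ l K k ≤ n) :
    2 * (K : ℝ) * (|lam n - l| / l) + 2 * (K : ℝ) * (|α (n + 1) - α n| / α n ^ 2) ≤
      1 / ((k : ℝ) + 1) := by
  have hK0 : (0 : ℝ) < K := Nat.cast_pos.2 hK
  have hc : 0 < 4 * (K : ℝ) * ((k : ℝ) + 1) / l := by positivity
  have h1 := hθ₄.dist_le_one_div (Nat.ceil_pos.2 hc) ((le_max_left _ _).trans hn)
  have h2 := h1.trans (one_div_le_one_div_of_le hc (Nat.le_ceil _))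
  have h3 := hσ₄.dist_le_one_div (by positivity) ((le_max_right _ _).trans hn)
  rw [Real.dist_0_eq_abs, abs_of_nonneg (by positivity)] at h3
  rw [Real.dist_eq] at h2
  have h4 : |lam n - l| / l ≤ 1 / (4 * (K : ℝ) * ((k : ℝ) + 1)) := by
    rw [div_le_iff₀ hl]
    refine h2.trans (le_of_eq ?_)
    field_simp
  push_cast at h3
  have h5 : 2 * (K : ℝ) * (1 / (4 * (K : ℝ) * ((k : ℝ) + 1))) = 1 / ((k : ℝ) + 1) / 2 := by
    field_simp
    norm_num
  have h6 := mul_le_mul_of_nonneg_left h4 (show 0 ≤ 2 * (K : ℝ) by positivity)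
  have h7 := mul_le_mul_of_nonneg_left h3 (show 0 ≤ 2 * (K : ℝ) by positivity)
  linarith

end Rates

end HPPA

theorem mainTheorem3 {X : Type*} [MetricSpace X] [CompleteSpace X]
    -- `X` is a complete CAT(0) space, `C` a nonempty closed convex subset
    (W : X → X → ℝ → X) (hW : HPPA.IsCAT0 W)
    (C : Set X) (hCne : C.Nonempty) (hCcl : IsClosed C) (hCconv : HPPA.IsWConvex W C)
    -- nonexpansive self-maps of `C`, with a common fixed point `z`
    (T : ℕ → X → X) (hTmaps : ∀ n, Set.MapsTo (T n) C C)
    (hTnonexp : ∀ n, ∀ x ∈ C, ∀ y ∈ C, dist (T n x) (T n y) ≤ dist x y)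
    (z : X) (hzC : z ∈ C) (hz : ∀ n, T n z = z)
    (lam : ℕ → ℝ) (hlam : ∀ n, 0 < lam n) (hRes : HPPA.IsResolventLike C T lam)
    -- `lam n → l > 0` with rate of convergence `θ₄`
    (l : ℝ) (hl : 0 < l) (θ₄ : ℕ → ℕ) (hθ₄ : HPPA.IsRateOfConvergence lam l θ₄)
    (α : ℕ → ℝ) (hα : ∀ n, α n ∈ Set.Ioc (0 : ℝ) 1)
    (σ₁ : ℕ → ℕ) (hσ₁ : HPPA.IsRateOfDivergence α σ₁)
    (σ₄ : ℕ → ℕ)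
    (hσ₄ : HPPA.IsRateOfConvergence (fun n => |α (n + 1) - α n| / (α n) ^ 2) 0 σ₄)
    (u x₀ : X) (hu : u ∈ C) (hx₀ : x₀ ∈ C)
    (K : ℕ) (hK : 1 ≤ K) (hKx : dist x₀ z ≤ K) (hKu : dist u z ≤ K) :
    -- the pointwise limit of `(T n)` on `C` and the Browder-type sequence are well defined
    (∀ x ∈ C, HPPA.limitMap T x ∈ C ∧
      Filter.Tendsto (fun n => T n x) Filter.atTop (nhds (HPPA.limitMap T x))) ∧
    (∀ n, HPPA.IsBrowderPoint W C α T u n (HPPA.browderSeq W C α T u n) ∧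
      ∀ y, HPPA.IsBrowderPoint W C α T u n y → y = HPPA.browderSeq W C α T u n) ∧
    HPPA.IsRateOfConvergence
      (fun n => dist (HPPA.hppa W α T u x₀ n) (HPPA.browderSeq W C α T u n)) 0
      (HPPA.sigmaStar σ₁ σ₄ θ₄ l K) ∧
    -- `M = 3 * K` is an admissible bound
    (∀ n, dist (HPPA.browderSeq W C α T u n) u ≤ ((3 * K : ℕ) : ℝ)) ∧
    (∀ M : ℕ, 1 ≤ M → (∀ n, dist (HPPA.browderSeq W C α T u n) u ≤ M) →
      (Antitone α →
        HPPA.IsCauchyWithMetastabilityRate (HPPA.browderSeq W C α T u) (HPPA.omegaMono M) ∧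
        HPPA.IsCauchyWithMetastabilityRate (HPPA.hppa W α T u x₀)
          (HPPA.phiStar (HPPA.sigmaStar σ₁ σ₄ θ₄ l K) (HPPA.omegaMono M))) ∧
      (∀ σ₃ h : ℕ → ℕ, HPPA.IsRateOfConvergence α 0 σ₃ →
        (∀ n, 1 / ((h n : ℝ) + 1) ≤ α n) →
        HPPA.IsCauchyWithMetastabilityRate (HPPA.browderSeq W C α T u)
          (HPPA.omegaZero σ₃ h M) ∧
        HPPA.IsCauchyWithMetastabilityRate (HPPA.hppa W α T u x₀)
          (HPPA.phiStar (HPPA.sigmaStar σ₁ σ₄ θ₄ l K) (HPPA.omegaZero σ₃ h M)))) := by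
  have hW' := hW.toIsWHyperbolic
  have hlim := hθ₄.tendsto
  have hT : ∀ x ∈ C, Tendsto (fun n => T n x) atTop (𝓝 (HPPA.limitMap T x)) := fun x hx =>
    HPPA.tendsto_limitMap hTnonexp hzC hz hRes hl hlim hx
  have hSmaps : Set.MapsTo (HPPA.limitMap T) C C := fun x hx =>
    hCcl.mem_of_tendsto (hT x hx) (Eventually.of_forall fun n => hTmaps n hx)
  have hS : ∀ x ∈ C, ∀ y ∈ C, dist (HPPA.limitMap T x) (HPPA.limitMap T y) ≤ dist x y :=
    fun x hx y hy => le_of_tendsto' ((hT x hx).dist (hT y hy)) fun n => hTnonexp n x hx y hy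
  have hSz : HPPA.limitMap T z = z :=
    tendsto_nhds_unique (hT z hzC) (by simp only [hz]; exact tendsto_const_nhds)
  have hy : ∀ n, HPPA.IsAnchoredFixedPoint W C (HPPA.limitMap T) u (α n)
      (HPPA.browderSeq W C α T u n) := fun n =>
    Classical.epsilon_spec (p := HPPA.IsBrowderPoint W C α T u n)
      (HPPA.exists_isAnchoredFixedPoint hW' hCcl hCconv hSmaps hS hu (hα n))
  have hzy : ∀ n, dist z (HPPA.browderSeq W C α T u n) ≤ K := fun n =>
    ((hy n).dist_le hW' hS hzC hSz (hα n)).trans (by rwa [dist_comm])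
  have huS : ∀ n, dist u (HPPA.limitMap T (HPPA.browderSeq W C α T u n)) ≤ 2 * (K : ℝ) := by
    intro n
    have h1 := hS z hzC _ (hy n).1
    rw [hSz] at h1
    linarith [dist_triangle u z (HPPA.limitMap T (HPPA.browderSeq W C α T u n)), hzy n]
  have hyu : ∀ n, dist (HPPA.browderSeq W C α T u n) u ≤ ((3 * K : ℕ) : ℝ) := by
    intro n
    have h1 := dist_triangle_left (HPPA.browderSeq W C α T u n) u z
    rw [dist_comm z u] at h1
    push_cast
    linarith [hzy n, K.cast_nonneg (α := ℝ)]
  have hrate : HPPA.IsRateOfConvergence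
      (fun n => dist (HPPA.hppa W α T u x₀ n) (HPPA.browderSeq W C α T u n)) 0
      (HPPA.sigmaStar σ₁ σ₄ θ₄ l K) := by
    intro k n hn
    rw [Real.dist_0_eq_abs, abs_of_nonneg dist_nonneg]
    refine HPPA.rate_of_recursion (L := 2 * (K : ℝ)) (σ := σ₁) (ψ := HPPA.psiStar σ₄ θ₄ l K)
      (s := fun n => dist (HPPA.hppa W α T u x₀ n) (HPPA.browderSeq W C α T u n))
      (by positivity) (fun n => ?_) hα hσ₁
      (fun n => HPPA.dist_hppa_succ_le hW' hCconv hTmaps hTnonexp hS hα hu hx₀ hy huS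
        (r := |lam n - l| / l) (by positivity)
        (HPPA.dist_limitMap_le hRes hl hlim (hy n).1 (hT _ (hy n).1) n))
      (HPPA.perturbation_le_of_psiStar_le hl hθ₄ hσ₄ hK) k n ?_
    · have h1 := HPPA.dist_hppa_le hW' hCconv hTmaps hTnonexp hzC hz hα hu hx₀ hKx hKu n
      have h2 := dist_triangle_left (HPPA.hppa W α T u x₀ n) (HPPA.browderSeq W C α T u n) z
      linarith [hzy n]
    · rw [show 2 * (2 * (K : ℝ)) = 4 * (K : ℝ) by ring]
      exact hn
  refine ⟨fun x hx => ⟨hSmaps hx, hT x hx⟩,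
    fun n => ⟨hy n, fun y hy' => HPPA.IsAnchoredFixedPoint.unique hW hS hy' (hy n) (hα n)⟩,
    hrate, hyu, fun M hM hyM => ⟨fun hanti => ?_, fun σ₃ h hσ₃ hh => ?_⟩⟩
  · have hmeta := HPPA.isRateOfMetastability_omegaMono hW hS hα hy hM hyM hanti
    have hmeta' := hmeta.of_dist_tendsto_zero hrate
    exact ⟨⟨hmeta.cauchySeq, hmeta⟩, hmeta'.cauchySeq, hmeta'⟩
  · have hmeta := HPPA.isRateOfMetastability_omegaZero hW hCcl hCconv hSmaps hS hu hα hy hM hyM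
      hσ₃ hh
    have hmeta' := hmeta.of_dist_tendsto_zero hrate
    exact ⟨⟨hmeta.cauchySeq, hmeta⟩, hmeta'.cauchySeq, hmeta'⟩
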